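/- Let $P\subset\mathbb R^3\subset S^3=\mathbb R^3\cup\{\infty\}$ be the projection plane. Consider a knot or link $K\subset\mathbb R^3$ (finitely many, at least one, disjoint simple closed curves) together with finitely many disjoint generalized twist regions, lying in pairwise disjoint closed balls $B_1,\dots,B_k$ that are symmetric with respect to $P$ (images of the unit ball under open embeddings of $\mathbb R^3$ commuting with the reflection in $P$), such that outside the balls $K$ lies in $P$, and $K\cap B_i$ consists of $m_i\ge 2$ strands running in parallel on an embedded ribbon surface that makes $n_i\in\mathbb Z$ half twists (counted with sign; if all full twists have been removed, $n_i\in\{0,\pm1\}$). In each $B_i$ insert a crossing circle $C_i$, an unknotted circle symmetric with respect to $P$ that bounds a crossing disk in $B_i$ met once by each strand. A generalized augmented link is a link $L\subset S^3$ that is carried by a self-homeomorphism of $S^3$ to a link $K\cup C_1\cup\dots\cup C_k$ of this form. Proposition. Let $L=F(K\cup C_1\cup\dots\cup C_k)$ be a generalized augmented link, where $F:S^3\to S^3$ is a homeomorphism. Then the complement $S^3\setminus L$ admits a homeomorphism $\sigma\neq\mathrm{id}$ with $\sigma^2=\mathrm{id}$ whose fixed point set is a nonempty (possibly disconnected) closed,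 locally flatly embedded surface in $S^3\setminus L$. Explicitly, $\sigma=F\circ(\tau\circ r)\circ F^{-1}$ on $S^3\setminus L$, where $r$ is the reflection of $S^3$ in $P\cup\{\infty\}$ and $\tau$ is the composition of the $n_i$-fold full twists about the crossing circles $C_i$, the $i$-th one supported in $B_i$. In particular, if $n_i\in\{0,\pm1\}$ for all $i$, then $\sigma$ is the reflection in the projection plane followed by one full twist about each crossing circle that carries a half twist. -/

import Mathlib

open Set Function

noncomputable section

namespace AugLink

/-- Euclidean three-space, with coordinates `p 0, p 1, p 2`. -/
abbrev E3 : Type := EuclideanSpace ℝ (Fin 3)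

/-- The three-sphere, as the one-point compactification of `ℝ³`. -/
abbrev S3 : Type := OnePoint E3

/-- The projection plane `p 2 = 0` in `ℝ³`. -/
def projectionPlane : Set E3 := {p | p 2 = 0}

/-- Reflection of `ℝ³` in the projection plane. -/
def reflect (p : E3) : E3 := !₂[p 0, p 1, -p 2]

/-- The closed unit ball, in which the model of a generalized twist region lives. -/
def modelBall : Set E3 := Metric.closedBall 0 1

/-- The model crossing circle: the unit circle in the plane `p 1 = 0`, which is perpendicular to
the projection plane. It bounds the flat unit disk in that plane (the model crossing disk), and
the strands of the twist region run through that disk in the direction of the `p 1`-axis. -/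
def modelCircle : Set E3 := {p | p 1 = 0 ∧ p 0 ^ 2 + p 2 ^ 2 = 1}

/-- Rotation by the angle `θ` about the `p 1`-axis. -/
def rotate (θ : ℝ) (p : E3) : E3 :=
  !₂[p 0 * Real.cos θ - p 2 * Real.sin θ, p 1, p 0 * Real.sin θ + p 2 * Real.cos θ]

/-- The relative height of a point of the unit ball between the two hemispheres bounded by the
model crossing circle: it is `-1` on the hemisphere `p 1 < 0`, `0` on the open crossing disk, and
`1` on the hemisphere `p 1 > 0`. It is continuous on the ball minus the crossing circle, and its
level sets are disks that meet along the crossing circle. -/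
def relHeight (p : E3) : ℝ := p 1 / Real.sqrt (1 - p 0 ^ 2 - p 2 ^ 2)

/-- Twisting of the unit ball minus the model crossing circle through the total angle `β`: the disk
of relative height `h` is rotated by `β * (1 + h) / 2`, that is, by an angle that increases
from `0` on the lower to `β` on the upper hemisphere. -/
def ballTwist (β : ℝ) (p : E3) : E3 := rotate (β * ((1 + relHeight p) / 2)) p

/-- `n` full twists (total angle `2πn`) about the model crossing circle: a homeomorphism of `ℝ³`
minus that circle, supported in the unit ball. The value on the circle itself is irrelevant. -/
def modelFullTwist (n : ℤ) (p : E3) : E3 :=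
  open Classical in if p ∈ modelBall then ballTwist (2 * Real.pi * n) p else p

/-- The strand with offset `s` on the model ribbon surface with `n` half twists: the ribbon is
the flat one `p 2 = 0`, twisted through the total angle `πn`. -/
def modelStrand (n : ℤ) (s : ℝ) : Set E3 :=
  ballTwist (Real.pi * n) '' {p | p ∈ modelBall ∧ p 0 = s ∧ p 2 = 0}

/-- A generalized twist region over the projection plane: at least two strands which run in
parallel on a ribbon surface that makes `halfTwists` half twists (with sign; two half
twists of the same sign are a full twist, and `0` and `±1` are the cases that are left when all
full twists have been removed). It is the image of the model in the unit ball under an open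
embedding that respects the reflection in the projection plane. -/
structure TwistRegion where
  chart : E3 → E3
  isOpenEmbedding_chart : Topology.IsOpenEmbedding chart
  chart_reflect : ∀ p, chart (reflect p) = reflect (chart p)
  halfTwists : ℤ
  numStrands : ℕ
  two_le_numStrands : 2 ≤ numStrands
  offset : Fin numStrands → ℝ
  strictMono_offset : StrictMono offset
  offset_mem : ∀ j, offset j ∈ Ioo (-1 : ℝ) 1

namespace TwistRegion

variable (T : TwistRegion)

/-- The closed ball that contains the twist region. -/
def ball : Set E3 := T.chart '' modelBall

/-- The crossing circle that encircles the twist region. -/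
def crossingCircle : Set E3 := T.chart '' modelCircle

/-- The strands of the twist region. -/
def strands : Set E3 := T.chart '' ⋃ j, modelStrand T.halfTwists (T.offset j)

/-- The full twists about the crossing circle, one for each half twist that the region carries
(so a single full twist for a single half twist, and the identity if there is none),
extended by the identity outside the ball. -/
def fullTwist (p : E3) : E3 :=
  open Classical in
  if p ∈ T.ball then T.chart (modelFullTwist T.halfTwists (Function.invFun T.chart p)) else p

end TwistRegion

/-- An augmented link diagram: a knot or link `knot` in `ℝ³` (finitely many disjoint simple closed
curves) with a choice of finitely many disjoint generalized twist regions, such that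
`knot` lies in the projection plane outside the twist regions and consists exactly of
the strands of the region inside each of them. -/
structure Diagram where
  numComponents : ℕ
  numComponents_pos : 0 < numComponents
  component : Fin numComponents → Circle → E3
  continuous_component : ∀ j, Continuous (component j)
  injective_component : Function.Injective fun q : Fin numComponents × Circle => component q.1 q.2
  numRegions : ℕ
  region : Fin numRegions → TwistRegion
  disjoint_ball : ∀ i j, i ≠ j → Disjoint (region i).ball (region j).ball
  knot_inter_ball : ∀ i, (⋃ j, range (component j)) ∩ (region i).ball = (region i).strands
  planar_outside : (⋃ j, range (component j)) \ (⋃ i, (region i).ball) ⊆ projectionPlane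

namespace Diagram

variable (D : Diagram)

/-- The knotting strands: the components of the original link. -/
def knot : Set E3 := ⋃ j, range (D.component j)

/-- The generalized augmented link of the diagram, in the three-sphere: the knotting strands and
a crossing circle around each generalized twist region. -/
def link : Set S3 := (fun p : E3 => (p : S3)) '' (D.knot ∪ ⋃ i, (D.region i).crossingCircle)

/-- The composition of the full twists about all crossing circles (they have disjoint supports,
so the order is irrelevant). -/
def totalTwist : E3 → E3 :=
  (List.ofFn fun i => (D.region i).fullTwist).foldr (fun f g => f ∘ g) id

/-- Reflection of the three-sphere in the projection plane (with the point at infinity), followed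
by the full twists about the crossing circles that carry half twists. -/
def twistedReflection : S3 → S3 := OnePoint.map (D.totalTwist ∘ reflect)

end Diagram

/-- `S` is an embedded surface in the three-manifold `X`: a closed subset that near each of its
points looks like a coordinate plane in `ℝ³`. -/
def IsEmbeddedSurface {X : Type*} [TopologicalSpace X] (S : Set X) : Prop :=
  IsClosed S ∧ ∀ p ∈ S, ∃ φ : OpenPartialHomeomorph X E3, p ∈ φ.source ∧
    ∀ q ∈ φ.source, (q ∈ S ↔ (φ q) 2 = 0)

end AugLink

end

/-! On the disk of relative height `h`, the full twists rotate by `2a`, where `a = πn(1 + h)/2` is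
the angle at which the ribbon with `n` half twists crosses that disk. Reflection followed by
rotation by `2a` is the reflection in the line at angle `a` (`rotate_reflect_eq_self_iff`). It is
therefore an involution and fixes exactly the line at angle `a`, which contains the ribbon. So the
twisted reflection fixes every strand inside the balls, and outside them it is the plain reflection,
which fixes the planar part of the knot (`twist_eq_self_of_mem_knot`).

Continuity can fail only at the crossing circles, where all the disks meet. These circles are
invariant and belong to the link, so a homeomorphism of the complement remains.

Each fixed point off the link needs a chart that flattens the fixed set (`exists_chart`). Away from
the balls the inclusion of `ℝ³` does it, and at infinity an inversion, which preserves the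
projection plane. In a ball, rotating back by `a` straightens the ribbon (`untwist`). On the
boundary sphere the angles are `0` and `πn`; clamping the height extends the formula past the
sphere, so no separate gluing is needed. -/

namespace AugLink

open Topology Filter

/-! ### Reflections, rotations and full twists in the model ball. -/

section Model

@[simp] lemma reflect_zero (p : E3) : reflect p 0 = p 0 := by simp [reflect]
@[simp] lemma reflect_one (p : E3) : reflect p 1 = p 1 := by simp [reflect]
@[simp] lemma reflect_two (p : E3) : reflect p 2 = -p 2 := by simp [reflect]

@[simp] lemma rotate_zero (θ : ℝ) (p : E3) :
    rotate θ p 0 = p 0 * Real.cos θ - p 2 * Real.sin θ := by simp [rotate]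
@[simp] lemma rotate_one (θ : ℝ) (p : E3) : rotate θ p 1 = p 1 := by simp [rotate]
@[simp] lemma rotate_two (θ : ℝ) (p : E3) :
    rotate θ p 2 = p 0 * Real.sin θ + p 2 * Real.cos θ := by simp [rotate]

lemma ext_coord {p q : E3} (h0 : p 0 = q 0) (h1 : p 1 = q 1) (h2 : p 2 = q 2) : p = q := by
  ext i
  fin_cases i <;> assumption

@[simp] lemma reflect_reflect (p : E3) : reflect (reflect p) = p := by
  apply ext_coord <;> simp

lemma continuous_reflect : Continuous reflect := by
  unfold reflect
  fun_prop

lemma continuous_rotate : Continuous fun q : ℝ × E3 => rotate q.1 q.2 := by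
  unfold rotate
  fun_prop

/-- Reflection in the projection plane, as a homeomorphism. -/
def reflectHomeo : E3 ≃ₜ E3 where
  toFun := reflect
  invFun := reflect
  left_inv := reflect_reflect
  right_inv := reflect_reflect
  continuous_toFun := continuous_reflect
  continuous_invFun := continuous_reflect

lemma reflect_eq_self_iff {p : E3} : reflect p = p ↔ p 2 = 0 := by
  constructor
  · intro h
    have := congrArg (fun q : E3 => q 2) h
    simp only [reflect_two] at this
    linarith
  · intro h
    apply ext_coord <;> simp [h]

lemma rotate_rotate (a b : ℝ) (p : E3) : rotate a (rotate b p) = rotate (a + b) p := by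
  apply ext_coord <;> simp only [rotate_zero, rotate_one, rotate_two, Real.cos_add, Real.sin_add]
  all_goals ring

@[simp] lemma rotate_angle_zero (p : E3) : rotate 0 p = p := by
  apply ext_coord <;> simp

@[simp] lemma rotate_neg_rotate (a : ℝ) (p : E3) : rotate (-a) (rotate a p) = p := by
  simp [rotate_rotate]

@[simp] lemma rotate_rotate_neg (a : ℝ) (p : E3) : rotate a (rotate (-a) p) = p := by
  simp [rotate_rotate]

lemma reflect_rotate (a : ℝ) (p : E3) : reflect (rotate a p) = rotate (-a) (reflect p) := by
  apply ext_coord <;> simp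
  ring

lemma rotate_two_pi_int (n : ℤ) (p : E3) : rotate (2 * Real.pi * n) p = p := by
  have hc : Real.cos (2 * Real.pi * n) = 1 := by
    rw [mul_comm]; exact Real.cos_int_mul_two_pi n
  have hs : Real.sin (2 * Real.pi * n) = 0 := by
    rw [show 2 * Real.pi * n = ((2 * n : ℤ) : ℝ) * Real.pi by push_cast; ring]
    exact Real.sin_int_mul_pi _
  apply ext_coord <;> simp [hc, hs]

/-- The composition of the reflection with the rotation by `2a` is the reflection in the line
at angle `a`. -/
lemma rotate_reflect_eq_self_iff {a : ℝ} {p : E3} :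
    rotate (2 * a) (reflect p) = p ↔ (rotate (-a) p) 2 = 0 := by
  -- The map is the conjugate of `reflect` by `rotate a`, so `p` is fixed exactly when `reflect`
  -- fixes `rotate (-a) p`.
  rw [← reflect_eq_self_iff, reflect_rotate, neg_neg, two_mul, ← rotate_rotate]
  constructor
  · intro h
    conv_rhs => rw [← h]
    simp
  · intro h
    rw [h]
    simp

/-- Squared distance to the axis of rotation. -/
def axisSq (p : E3) : ℝ := p 0 ^ 2 + p 2 ^ 2

@[simp] lemma axisSq_reflect (p : E3) : axisSq (reflect p) = axisSq p := by simp [axisSq]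

@[simp] lemma axisSq_rotate (a : ℝ) (p : E3) : axisSq (rotate a p) = axisSq p := by
  simp only [axisSq, rotate_zero, rotate_two]
  linear_combination (p 0 ^ 2 + p 2 ^ 2) * Real.sin_sq_add_cos_sq a

lemma continuous_axisSq : Continuous axisSq := by
  unfold axisSq
  fun_prop

lemma relHeight_eq (p : E3) : relHeight p = p 1 / Real.sqrt (1 - axisSq p) := by
  rw [relHeight, axisSq, sub_sub]

@[simp] lemma relHeight_reflect (p : E3) : relHeight (reflect p) = relHeight p := by
  simp [relHeight_eq]

@[simp] lemma relHeight_rotate (a : ℝ) (p : E3) : relHeight (rotate a p) = relHeight p := by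
  simp [relHeight_eq]

lemma mem_modelBall {p : E3} : p ∈ modelBall ↔ axisSq p + p 1 ^ 2 ≤ 1 := by
  rw [modelBall, mem_closedBall_zero_iff, ← sq_le_one_iff₀ (norm_nonneg p),
    EuclideanSpace.real_norm_sq_eq, Fin.sum_univ_three, axisSq]
  constructor <;> intro h <;> linarith

@[simp] lemma reflect_mem_modelBall {p : E3} : reflect p ∈ modelBall ↔ p ∈ modelBall := by
  simp [mem_modelBall]

@[simp] lemma rotate_mem_modelBall {a : ℝ} {p : E3} : rotate a p ∈ modelBall ↔ p ∈ modelBall := by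
  simp [mem_modelBall]

lemma isCompact_modelBall : IsCompact modelBall := isCompact_closedBall 0 1

lemma mem_modelCircle {p : E3} : p ∈ modelCircle ↔ p 1 = 0 ∧ axisSq p = 1 := Iff.rfl

lemma modelCircle_subset_modelBall : modelCircle ⊆ modelBall := by
  intro p hp
  obtain ⟨h1, h2⟩ := mem_modelCircle.1 hp
  rw [mem_modelBall, h1, h2]
  norm_num

lemma isCompact_modelCircle : IsCompact modelCircle := by
  refine isCompact_modelBall.of_isClosed_subset ?_ modelCircle_subset_modelBall
  exact (isClosed_eq (by fun_prop) continuous_const).inter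
    (isClosed_eq continuous_axisSq continuous_const)

@[simp] lemma reflect_mem_modelCircle {p : E3} : reflect p ∈ modelCircle ↔ p ∈ modelCircle := by
  simp [mem_modelCircle]

@[simp] lemma rotate_mem_modelCircle {a : ℝ} {p : E3} :
    rotate a p ∈ modelCircle ↔ p ∈ modelCircle := by
  simp [mem_modelCircle]

/-- The open solid cylinder around the unit ball. -/
def cylinder : Set E3 := {p | axisSq p < 1}

lemma isOpen_cylinder : IsOpen cylinder := isOpen_lt continuous_axisSq continuous_const

@[simp] lemma rotate_mem_cylinder {a : ℝ} {p : E3} : rotate a p ∈ cylinder ↔ p ∈ cylinder := by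
  simp [cylinder]

@[simp] lemma reflect_mem_cylinder {p : E3} : reflect p ∈ cylinder ↔ p ∈ cylinder := by
  simp [cylinder]

/-- The closed ball touches the boundary of the cylinder only along the crossing circle, so the
cylinder is an open neighbourhood of the rest of the ball. -/
lemma mem_cylinder_of_mem_modelBall {p : E3} (hp : p ∈ modelBall) (hc : p ∉ modelCircle) :
    p ∈ cylinder := by
  rw [mem_modelBall] at hp
  by_contra h
  have h' : 1 ≤ axisSq p := not_lt.1 h
  have h1 : p 1 ^ 2 = 0 := le_antisymm (by linarith) (sq_nonneg _)
  exact hc (mem_modelCircle.2 ⟨by simpa using h1, by linarith [sq_nonneg (p 1)]⟩)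

/-- The relative height, continued to the open cylinder by `1` above and `-1` below the ball. -/
noncomputable def clampedHeight (p : E3) : ℝ := max (-1) (min 1 (relHeight p))

@[simp] lemma clampedHeight_reflect (p : E3) : clampedHeight (reflect p) = clampedHeight p := by
  simp [clampedHeight]

@[simp] lemma clampedHeight_rotate (a : ℝ) (p : E3) :
    clampedHeight (rotate a p) = clampedHeight p := by
  simp [clampedHeight]

lemma continuousOn_clampedHeight : ContinuousOn clampedHeight cylinder := by
  have : ContinuousOn relHeight cylinder := by
    simp_rw [funext relHeight_eq]
    refine ContinuousOn.div (by fun_prop)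
      (Real.continuous_sqrt.comp (continuous_const.sub continuous_axisSq)).continuousOn ?_
    intro p hp
    have hp' : axisSq p < 1 := hp
    exact (Real.sqrt_pos.2 (by linarith)).ne'
  exact continuousOn_const.sup (continuousOn_const.inf this)

lemma clampedHeight_of_mem_modelBall {p : E3} (hp : p ∈ modelBall) (hc : p ∈ cylinder) :
    clampedHeight p = relHeight p := by
  have hc' : axisSq p < 1 := hc
  have hs : 0 < Real.sqrt (1 - axisSq p) := Real.sqrt_pos.2 (by linarith)
  have hle : |p 1| ≤ Real.sqrt (1 - axisSq p) :=
    Real.abs_le_sqrt (by rw [mem_modelBall] at hp; linarith)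
  have h : |relHeight p| ≤ 1 := by
    rw [relHeight_eq, abs_div, abs_of_pos hs]
    exact (div_le_one hs).2 hle
  rw [clampedHeight, min_eq_right (abs_le.1 h).2, max_eq_right (abs_le.1 h).1]

lemma clampedHeight_of_notMem_modelBall {p : E3} (hp : p ∉ modelBall) (hc : p ∈ cylinder) :
    clampedHeight p = 1 ∨ clampedHeight p = -1 := by
  have hc' : axisSq p < 1 := hc
  have hs : 0 < Real.sqrt (1 - axisSq p) := Real.sqrt_pos.2 (by linarith)
  have hle : Real.sqrt (1 - axisSq p) < |p 1| := by
    rw [Real.sqrt_lt' (lt_of_le_of_ne (abs_nonneg _) _), sq_abs]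
    · rw [mem_modelBall] at hp; linarith
    · intro h
      apply hp
      rw [mem_modelBall, abs_eq_zero.1 h.symm]
      linarith
  have h : 1 < |relHeight p| := by
    rw [relHeight_eq, abs_div, abs_of_pos hs]
    exact (one_lt_div hs).2 hle
  rcases lt_abs.1 h with h | h
  · left
    rw [clampedHeight, min_eq_left h.le, max_eq_right (by norm_num)]
  · right
    rw [clampedHeight, min_eq_right (by linarith), max_eq_left (by linarith)]

/-- The angle at which the twisted ribbon with `n` half twists passes the height of a point. -/
noncomputable def ribbonAngle (n : ℤ) (p : E3) : ℝ := Real.pi * n * ((1 + clampedHeight p) / 2)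

@[simp] lemma ribbonAngle_reflect (n : ℤ) (p : E3) :
    ribbonAngle n (reflect p) = ribbonAngle n p := by
  simp [ribbonAngle]

@[simp] lemma ribbonAngle_rotate (n : ℤ) (a : ℝ) (p : E3) :
    ribbonAngle n (rotate a p) = ribbonAngle n p := by
  simp [ribbonAngle]

lemma continuousOn_ribbonAngle (n : ℤ) : ContinuousOn (ribbonAngle n) cylinder :=
  continuousOn_const.mul ((continuousOn_const.add continuousOn_clampedHeight).div_const _)

lemma modelFullTwist_of_mem_modelBall (n : ℤ) {p : E3} (hp : p ∈ modelBall) :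
    modelFullTwist n p = ballTwist (2 * Real.pi * n) p := if_pos hp

lemma modelFullTwist_of_notMem_modelBall (n : ℤ) {p : E3} (hp : p ∉ modelBall) :
    modelFullTwist n p = p := if_neg hp

/-- Above and below the ball the clamped angle is `2πn` or `0`, and both rotations are the identity.
One continuous formula thus covers both sides of the sphere. -/
lemma modelFullTwist_eq_rotate (n : ℤ) {p : E3} (hc : p ∈ cylinder) :
    modelFullTwist n p = rotate (2 * ribbonAngle n p) p := by
  by_cases hp : p ∈ modelBall
  · rw [modelFullTwist_of_mem_modelBall n hp, ballTwist, ribbonAngle,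
      clampedHeight_of_mem_modelBall hp hc]
    congr 1
    ring
  · rw [modelFullTwist_of_notMem_modelBall n hp, ribbonAngle]
    rcases clampedHeight_of_notMem_modelBall hp hc with h | h <;> rw [h]
    · rw [show 2 * (Real.pi * n * ((1 + 1) / 2)) = 2 * Real.pi * n by ring, rotate_two_pi_int]
    · simp

@[simp] lemma modelFullTwist_mem_modelBall {n : ℤ} {p : E3} :
    modelFullTwist n p ∈ modelBall ↔ p ∈ modelBall := by
  by_cases hp : p ∈ modelBall
  · simp [modelFullTwist_of_mem_modelBall n hp, ballTwist]
  · simp [modelFullTwist_of_notMem_modelBall n hp]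

/-- The value on the circle is arbitrary, but it is still a rotation about the axis of the circle;
this keeps the link invariant. -/
lemma modelFullTwist_mem_modelCircle {n : ℤ} {p : E3} (hp : p ∈ modelCircle) :
    modelFullTwist n p ∈ modelCircle := by
  rw [modelFullTwist_of_mem_modelBall n (modelCircle_subset_modelBall hp), ballTwist]
  simpa

/-- The reflection followed by full twists about the model crossing circle is an involution. -/
lemma modelFullTwist_reflect_involutive (n : ℤ) :
    Involutive fun p => modelFullTwist n (reflect p) := by
  intro p
  by_cases hp : p ∈ modelBall
  · have hp' : reflect p ∈ modelBall := reflect_mem_modelBall.2 hp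
    dsimp only
    rw [modelFullTwist_of_mem_modelBall n hp', modelFullTwist_of_mem_modelBall n]
    -- The relative height is invariant, so the two rotation angles agree and cancel after passing
    -- through the reflection. This includes the crossing circle, where division by zero makes the
    -- height `0`.
    · simp [ballTwist, reflect_rotate]
    · simpa [ballTwist] using hp
  · have hp' : reflect p ∉ modelBall := by simpa using hp
    dsimp only
    rw [modelFullTwist_of_notMem_modelBall n hp', reflect_reflect,
      modelFullTwist_of_notMem_modelBall n hp]

/-- A ribbon point has been turned by half the angle of the full twists at its height, so it lies on
the axis of the line reflection there. -/
lemma modelFullTwist_reflect_of_mem_modelStrand {n : ℤ} {s : ℝ} {p : E3}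
    (hp : p ∈ modelStrand n s) : p ∈ modelBall ∧ modelFullTwist n (reflect p) = p := by
  obtain ⟨w, ⟨hw, -, hw2⟩, rfl⟩ := hp
  have hb : ballTwist (Real.pi * n) w ∈ modelBall := by simpa [ballTwist] using hw
  refine ⟨hb, ?_⟩
  rw [modelFullTwist_of_mem_modelBall n (reflect_mem_modelBall.2 hb)]
  simp only [ballTwist, relHeight_reflect, relHeight_rotate]
  rw [show 2 * Real.pi * n * ((1 + relHeight w) / 2)
    = 2 * (Real.pi * n * ((1 + relHeight w) / 2)) by ring, rotate_reflect_eq_self_iff]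
  simpa using hw2

lemma modelFullTwist_reflect_eq_self_iff (n : ℤ) {p : E3} (hc : p ∈ cylinder) :
    modelFullTwist n (reflect p) = p ↔ (rotate (-ribbonAngle n p) p) 2 = 0 := by
  rw [modelFullTwist_eq_rotate n (reflect_mem_cylinder.2 hc), ribbonAngle_reflect,
    rotate_reflect_eq_self_iff]

lemma continuousAt_modelFullTwist (n : ℤ) {p : E3} (hc : p ∉ modelCircle) :
    ContinuousAt (modelFullTwist n) p := by
  by_cases hp : p ∈ modelBall
  · have hV : cylinder ∈ 𝓝 p := isOpen_cylinder.mem_nhds (mem_cylinder_of_mem_modelBall hp hc)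
    have : ContinuousOn (fun q => rotate (2 * ribbonAngle n q) q) cylinder :=
      continuous_rotate.comp_continuousOn
        ((continuousOn_const.mul (continuousOn_ribbonAngle n)).prodMk continuousOn_id)
    refine (this.continuousAt hV).congr ?_
    filter_upwards [hV] with q hq using (modelFullTwist_eq_rotate n hq).symm
  · refine continuousAt_id.congr ?_
    filter_upwards [isCompact_modelBall.isClosed.isOpen_compl.mem_nhds hp] with q hq
      using (modelFullTwist_of_notMem_modelBall n hq).symm

/-- The untwisting of the open cylinder that flattens the ribbon with `n` half twists. -/
noncomputable def untwist (n : ℤ) : OpenPartialHomeomorph E3 E3 where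
  toFun p := rotate (-ribbonAngle n p) p
  invFun p := rotate (ribbonAngle n p) p
  source := cylinder
  target := cylinder
  map_source' := by simp
  map_target' := by simp
  left_inv' := by simp
  right_inv' := by simp
  open_source := isOpen_cylinder
  open_target := isOpen_cylinder
  continuousOn_toFun := continuous_rotate.comp_continuousOn
    ((continuousOn_ribbonAngle n).neg.prodMk continuousOn_id)
  continuousOn_invFun := continuous_rotate.comp_continuousOn
    ((continuousOn_ribbonAngle n).prodMk continuousOn_id)

end Model

/-! ### Transport of the model to a twist region. -/

namespace TwistRegion

variable (T : TwistRegion)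

lemma chart_mem_ball {v : E3} : T.chart v ∈ T.ball ↔ v ∈ modelBall :=
  T.isOpenEmbedding_chart.injective.mem_set_image

lemma isCompact_ball : IsCompact T.ball :=
  isCompact_modelBall.image T.isOpenEmbedding_chart.continuous

lemma isCompact_crossingCircle : IsCompact T.crossingCircle :=
  isCompact_modelCircle.image T.isOpenEmbedding_chart.continuous

lemma crossingCircle_subset_ball : T.crossingCircle ⊆ T.ball :=
  image_mono modelCircle_subset_modelBall

lemma fullTwist_of_notMem {p : E3} (hp : p ∉ T.ball) : T.fullTwist p = p := if_neg hp

lemma fullTwist_chart (v : E3) :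
    T.fullTwist (T.chart v) = T.chart (modelFullTwist T.halfTwists v) := by
  by_cases hv : v ∈ modelBall
  · rw [fullTwist, if_pos (T.chart_mem_ball.2 hv),
      leftInverse_invFun T.isOpenEmbedding_chart.injective]
  · rw [fullTwist, if_neg (mt T.chart_mem_ball.1 hv), modelFullTwist_of_notMem_modelBall _ hv]

lemma fullTwist_mem_ball {p : E3} (hp : p ∈ T.ball) : T.fullTwist p ∈ T.ball := by
  obtain ⟨v, hv, rfl⟩ := hp
  rw [fullTwist_chart, chart_mem_ball]
  simpa

lemma reflect_mem_ball {p : E3} : reflect p ∈ T.ball ↔ p ∈ T.ball := by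
  have key : ∀ p ∈ T.ball, reflect p ∈ T.ball := by
    rintro _ ⟨v, hv, rfl⟩
    rw [← T.chart_reflect, chart_mem_ball]
    simpa
  exact ⟨fun h => by simpa using key _ h, key p⟩

end TwistRegion

/-! ### The twisted reflection of space and its action on the link. -/

namespace Diagram

variable (D : Diagram)

/-- The reflection in the projection plane followed by the full twists, on `ℝ³`. -/
noncomputable def twist (p : E3) : E3 := D.totalTwist (reflect p)

lemma totalTwist_eq_foldr :
    D.totalTwist = ((List.finRange D.numRegions).map fun i => (D.region i).fullTwist).foldr
      (fun f g => f ∘ g) id := by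
  rw [totalTwist, List.ofFn_eq_map]

lemma totalTwist_of_notMem {p : E3} (hp : ∀ i, p ∉ (D.region i).ball) : D.totalTwist p = p := by
  rw [totalTwist_eq_foldr]
  induction List.finRange D.numRegions with
  | nil => rfl
  | cons a l ih =>
    rw [List.map_cons, List.foldr_cons, comp_apply, ih, (D.region a).fullTwist_of_notMem (hp a)]

lemma totalTwist_of_mem {i : Fin D.numRegions} {p : E3} (hp : p ∈ (D.region i).ball) :
    D.totalTwist p = (D.region i).fullTwist p := by
  -- The induction needs sublists that may omit `i`; absence of duplicates ensures that the `i`-th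
  -- twist acts only once.
  have key : ∀ l : List (Fin D.numRegions), l.Nodup →
      ((l.map fun i => (D.region i).fullTwist).foldr (fun f g => f ∘ g) id) p
        = if i ∈ l then (D.region i).fullTwist p else p := by
    intro l
    induction l with
    | nil => simp
    | cons a l ih =>
      intro hl
      rw [List.nodup_cons] at hl
      rw [List.map_cons, List.foldr_cons, comp_apply, ih hl.2]
      by_cases ha : a = i
      · subst ha
        simp [hl.1]
      · have hia : i ≠ a := Ne.symm ha
        have hd := disjoint_left.1 (D.disjoint_ball i a hia)
        by_cases hil : i ∈ l
        · simp [hil, (D.region a).fullTwist_of_notMem (hd ((D.region i).fullTwist_mem_ball hp))]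
        · simp [hil, hia, (D.region a).fullTwist_of_notMem (hd hp)]
  rw [totalTwist_eq_foldr, key _ (List.nodup_finRange _), if_pos (List.mem_finRange i)]

lemma twist_of_notMem {p : E3} (hp : ∀ i, p ∉ (D.region i).ball) : D.twist p = reflect p :=
  D.totalTwist_of_notMem fun i => by simpa [TwistRegion.reflect_mem_ball] using hp i

/-- Only the other balls have to be avoided, so the formula holds on a neighbourhood of the `i`-th
ball. Continuity and charts at its boundary depend on this. -/
lemma twist_chart (i : Fin D.numRegions) {v : E3}
    (hv : ∀ j, j ≠ i → (D.region i).chart v ∉ (D.region j).ball) :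
    D.twist ((D.region i).chart v)
      = (D.region i).chart (modelFullTwist (D.region i).halfTwists (reflect v)) := by
  by_cases hb : v ∈ modelBall
  · rw [twist, ← TwistRegion.chart_reflect, D.totalTwist_of_mem (i := i),
      TwistRegion.fullTwist_chart]
    rw [TwistRegion.chart_mem_ball]
    simpa
  · rw [twist_of_notMem, ← TwistRegion.chart_reflect, modelFullTwist_of_notMem_modelBall]
    · simpa
    · intro j
      by_cases hj : j = i
      · subst hj
        rwa [TwistRegion.chart_mem_ball]
      · exact hv j hj

lemma twist_chart_of_mem (i : Fin D.numRegions) {v : E3} (hv : v ∈ modelBall) :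
    D.twist ((D.region i).chart v)
      = (D.region i).chart (modelFullTwist (D.region i).halfTwists (reflect v)) :=
  D.twist_chart i fun j hj =>
    disjoint_left.1 (D.disjoint_ball i j hj.symm) ((D.region i).chart_mem_ball.2 hv)

lemma twist_involutive : Involutive D.twist := by
  intro p
  by_cases hp : ∃ i, p ∈ (D.region i).ball
  · obtain ⟨i, v, hv, rfl⟩ := hp
    rw [D.twist_chart_of_mem i hv, D.twist_chart_of_mem i (by simpa)]
    exact congrArg _ (modelFullTwist_reflect_involutive _ v)
  · push Not at hp
    rw [D.twist_of_notMem hp, D.twist_of_notMem, reflect_reflect]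
    intro i
    rw [TwistRegion.reflect_mem_ball]
    exact hp i

/-- The union of the balls around the twist regions. -/
def balls : Set E3 := ⋃ i, (D.region i).ball

lemma isCompact_balls : IsCompact D.balls := isCompact_iUnion fun i => (D.region i).isCompact_ball

lemma twist_of_notMem_balls {p : E3} (hp : p ∉ D.balls) : D.twist p = reflect p :=
  D.twist_of_notMem fun i hi => hp (mem_iUnion_of_mem i hi)

/-- The union of the crossing circles. -/
def circles : Set E3 := ⋃ i, (D.region i).crossingCircle

lemma isCompact_knot_union_circles : IsCompact (D.knot ∪ D.circles) :=
  (isCompact_iUnion fun j => isCompact_range (D.continuous_component j)).union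
    (isCompact_iUnion fun i => (D.region i).isCompact_crossingCircle)

lemma twist_eq_self_of_mem_knot {p : E3} (hp : p ∈ D.knot) : D.twist p = p := by
  by_cases hb : p ∈ D.balls
  · obtain ⟨i, hi⟩ := mem_iUnion.1 hb
    have hs : p ∈ (D.region i).strands := D.knot_inter_ball i ▸ ⟨hp, hi⟩
    obtain ⟨v, hv, rfl⟩ := hs
    obtain ⟨j, hj⟩ := mem_iUnion.1 hv
    obtain ⟨h1, h2⟩ := modelFullTwist_reflect_of_mem_modelStrand hj
    rw [D.twist_chart_of_mem i h1, h2]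
  · rw [D.twist_of_notMem_balls hb, reflect_eq_self_iff]
    exact D.planar_outside ⟨hp, hb⟩

lemma twist_mem {p : E3} (hp : p ∈ D.knot ∪ D.circles) : D.twist p ∈ D.knot ∪ D.circles := by
  rcases hp with hp | hp
  · rw [D.twist_eq_self_of_mem_knot hp]
    exact Or.inl hp
  · obtain ⟨i, v, hv, rfl⟩ := mem_iUnion.1 hp
    right
    rw [D.twist_chart_of_mem i (modelCircle_subset_modelBall hv)]
    exact mem_iUnion_of_mem i
      (mem_image_of_mem _ (modelFullTwist_mem_modelCircle (reflect_mem_modelCircle.2 hv)))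

lemma twist_mem_iff {p : E3} : D.twist p ∈ D.knot ∪ D.circles ↔ p ∈ D.knot ∪ D.circles :=
  ⟨fun h => D.twist_involutive p ▸ D.twist_mem h, D.twist_mem⟩

/-- The complement of the balls around the twist regions other than the `i`-th one. -/
def awayFromOthers (i : Fin D.numRegions) : Set E3 := ⋂ j, {p | j ≠ i → p ∉ (D.region j).ball}

lemma mem_awayFromOthers {i : Fin D.numRegions} {p : E3} :
    p ∈ D.awayFromOthers i ↔ ∀ j, j ≠ i → p ∉ (D.region j).ball := by
  simp [awayFromOthers]

lemma isOpen_awayFromOthers (i : Fin D.numRegions) : IsOpen (D.awayFromOthers i) := by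
  refine isOpen_iInter_of_finite fun j => ?_
  by_cases hj : j = i
  · simp [hj]
  · have h : {p | j ≠ i → p ∉ (D.region j).ball} = (D.region j).ballᶜ := by
      ext p
      simp [hj]
    exact h ▸ (D.region j).isCompact_ball.isClosed.isOpen_compl

lemma ball_subset_awayFromOthers (i : Fin D.numRegions) :
    (D.region i).ball ⊆ D.awayFromOthers i := fun _ hp =>
  D.mem_awayFromOthers.2 fun j hj => disjoint_left.1 (D.disjoint_ball i j hj.symm) hp

lemma continuousAt_twist {p : E3} (hp : p ∉ D.circles) : ContinuousAt D.twist p := by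
  by_cases hb : p ∈ D.balls
  · obtain ⟨i, hi⟩ := mem_iUnion.1 hb
    obtain ⟨v, hv, rfl⟩ := id hi
    have hc : v ∉ modelCircle := fun h => hp (mem_iUnion_of_mem i (mem_image_of_mem _ h))
    rw [← (D.region i).isOpenEmbedding_chart.continuousAt_iff]
    have hcont : ContinuousAt (fun w => (D.region i).chart
        (modelFullTwist (D.region i).halfTwists (reflect w))) v :=
      (D.region i).isOpenEmbedding_chart.continuous.continuousAt.comp
        (ContinuousAt.comp (continuousAt_modelFullTwist _ (by simpa))
          continuous_reflect.continuousAt)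
    refine hcont.congr ?_
    have hU : (D.region i).chart ⁻¹' D.awayFromOthers i ∈ 𝓝 v :=
      ((D.isOpen_awayFromOthers i).preimage
        (D.region i).isOpenEmbedding_chart.continuous).mem_nhds (D.ball_subset_awayFromOthers i hi)
    filter_upwards [hU] with w hw using (D.twist_chart i (D.mem_awayFromOthers.1 hw)).symm
  · refine continuous_reflect.continuousAt.congr ?_
    filter_upwards [D.isCompact_balls.isClosed.isOpen_compl.mem_nhds hb] with q hq
      using (D.twist_of_notMem_balls hq).symm

/-! ### Extension to the three-sphere. -/

lemma twistedReflection_coe (p : E3) : D.twistedReflection (p : S3) = (D.twist p : S3) := rfl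

lemma twistedReflection_infty : D.twistedReflection OnePoint.infty = OnePoint.infty := rfl

lemma twistedReflection_involutive : Involutive D.twistedReflection := by
  intro x
  induction x using OnePoint.rec with
  | infty => rfl
  | coe p => rw [twistedReflection_coe, twistedReflection_coe, D.twist_involutive]

lemma coe_mem_link {p : E3} : (p : S3) ∈ D.link ↔ p ∈ D.knot ∪ D.circles :=
  OnePoint.coe_injective.mem_set_image

lemma infty_notMem_link : OnePoint.infty ∉ D.link := by
  rintro ⟨p, -, hp⟩
  exact OnePoint.coe_ne_infty p hp

lemma isClosed_link : IsClosed D.link :=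
  (D.isCompact_knot_union_circles.image OnePoint.continuous_coe).isClosed

lemma twistedReflection_mem_link {x : S3} : D.twistedReflection x ∈ D.link ↔ x ∈ D.link := by
  induction x using OnePoint.rec with
  | infty => rfl
  | coe p => rw [twistedReflection_coe, coe_mem_link, coe_mem_link, twist_mem_iff]

/-- At infinity only the complement of the compact balls matters, where the map is the proper map
`reflect`. -/
lemma continuousAt_twistedReflection {x : S3} (hx : x ∉ D.link) :
    ContinuousAt D.twistedReflection x := by
  induction x using OnePoint.rec with
  | infty =>
    rw [OnePoint.continuousAt_infty', twistedReflection_infty]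
    have h : Tendsto (fun p : E3 => (reflect p : S3)) (coclosedCompact E3) (𝓝 OnePoint.infty) := by
      rw [coclosedCompact_eq_cocompact]
      refine Tendsto.comp ?_ reflectHomeo.isClosedEmbedding.tendsto_cocompact
      rw [← coclosedCompact_eq_cocompact]
      exact OnePoint.tendsto_coe_infty
    refine h.congr' ?_
    rw [coclosedCompact_eq_cocompact]
    filter_upwards [D.isCompact_balls.compl_mem_cocompact] with p hp
    rw [comp_apply, twistedReflection_coe, D.twist_of_notMem_balls hp]
  | coe p =>
    rw [OnePoint.continuousAt_coe]
    have hp : p ∉ D.circles := fun h => hx (D.coe_mem_link.2 (Or.inr h))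
    exact OnePoint.continuous_coe.continuousAt.comp (D.continuousAt_twist hp)

end Diagram

/-! ### Affine and inverted coordinates of the three-sphere. -/

section Charts

/-- The coordinates of the three-sphere given by the inclusion of `ℝ³`. -/
noncomputable def affineChart : OpenPartialHomeomorph S3 E3 :=
  (OnePoint.isOpenEmbedding_coe.toOpenPartialHomeomorph (fun p : E3 => (p : S3))).symm

@[simp] lemma coe_mem_affineChart_source (p : E3) : (p : S3) ∈ affineChart.source := by
  simp [affineChart]

@[simp] lemma affineChart_coe (p : E3) : affineChart (p : S3) = p :=
  (OnePoint.isOpenEmbedding_coe.toOpenPartialHomeomorph (fun p : E3 => (p : S3))).left_inv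
    (mem_univ p)

lemma infty_notMem_affineChart_source : OnePoint.infty ∉ affineChart.source := by
  simp [affineChart]

/-- Inversion in the unit sphere, as a map that sends the point at infinity to the origin. -/
noncomputable def inversion (x : S3) : E3 := x.elim 0 fun p => (‖p‖ ^ 2)⁻¹ • p

@[simp] lemma inversion_infty : inversion OnePoint.infty = 0 := rfl

@[simp] lemma inversion_coe (p : E3) : inversion (p : S3) = (‖p‖ ^ 2)⁻¹ • p := rfl

/-- Inversion in the unit sphere, as a map that sends the origin to the point at infinity. -/
noncomputable def inversionInv (p : E3) : S3 :=
  open Classical in if p = 0 then OnePoint.infty else (((‖p‖ ^ 2)⁻¹ • p : E3) : S3)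

lemma inv_norm_sq_smul_involutive : Involutive fun p : E3 => (‖p‖ ^ 2)⁻¹ • p := by
  intro p
  by_cases hp : p = 0
  · simp [hp]
  · have : ‖p‖ ≠ 0 := norm_ne_zero_iff.2 hp
    simp only [norm_smul, smul_smul, norm_inv, norm_pow, norm_norm]
    convert one_smul ℝ p
    field_simp

/-- Reduces the limits of the inversion at `0` and at infinity to those of the real function `t⁻¹`.
-/
lemma norm_inv_norm_sq_smul (p : E3) : ‖(‖p‖ ^ 2)⁻¹ • p‖ = ‖p‖⁻¹ := by
  by_cases hp : p = 0
  · simp [hp]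
  · have : ‖p‖ ≠ 0 := norm_ne_zero_iff.2 hp
    simp only [norm_smul, norm_inv, norm_pow, norm_norm]
    field_simp

lemma continuousAt_inv_norm_sq_smul {p : E3} (hp : p ≠ 0) :
    ContinuousAt (fun p : E3 => (‖p‖ ^ 2)⁻¹ • p) p := by
  have : ‖p‖ ^ 2 ≠ 0 := pow_ne_zero 2 (norm_ne_zero_iff.2 hp)
  fun_prop (disch := assumption)

lemma continuousAt_inversion {x : S3} (hx : x ≠ ((0 : E3) : S3)) : ContinuousAt inversion x := by
  induction x using OnePoint.rec with
  | infty =>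
    rw [OnePoint.continuousAt_infty', inversion_infty, coclosedCompact_eq_cocompact,
      tendsto_zero_iff_norm_tendsto_zero]
    simp only [comp_apply, inversion_coe, norm_inv_norm_sq_smul]
    exact tendsto_inv_atTop_zero.comp (tendsto_norm_cocompact_atTop (E := E3))
  | coe p =>
    rw [OnePoint.continuousAt_coe]
    exact continuousAt_inv_norm_sq_smul fun h => hx (by rw [h])

lemma continuous_inversionInv : Continuous inversionInv := by
  rw [continuous_iff_continuousAt]
  intro p
  by_cases hp : p = 0
  · subst hp
    rw [continuousAt_iff_punctured_nhds]
    have h : Tendsto (fun p : E3 => (((‖p‖ ^ 2)⁻¹ • p : E3) : S3)) (𝓝[≠] 0)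
        (𝓝 OnePoint.infty) := by
      refine Tendsto.comp (OnePoint.tendsto_coe_infty (X := E3)) ?_
      rw [coclosedCompact_eq_cocompact, ← Metric.cobounded_eq_cocompact,
        ← tendsto_norm_atTop_iff_cobounded]
      simp only [norm_inv_norm_sq_smul]
      exact tendsto_inv_nhdsGT_zero.comp (tendsto_norm_nhdsNE_zero (E := E3))
    have h0 : inversionInv 0 = OnePoint.infty := if_pos rfl
    rw [h0]
    refine h.congr' ?_
    filter_upwards [self_mem_nhdsWithin] with q hq using (if_neg hq).symm
  · refine (OnePoint.continuous_coe.continuousAt.comp (continuousAt_inv_norm_sq_smul hp)).congr ?_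
    filter_upwards [isOpen_ne.mem_nhds hp] with q hq using (if_neg hq).symm

/-- The coordinates of the three-sphere given by inversion, centred at the point at infinity. -/
noncomputable def inftyChart : OpenPartialHomeomorph S3 E3 where
  toFun := inversion
  invFun := inversionInv
  source := {((0 : E3) : S3)}ᶜ
  target := univ
  map_source' := by simp
  map_target' := by
    intro p _
    by_cases hp : p = 0
    · simp [inversionInv, hp]
    · simp [inversionInv, hp]
  left_inv' := by
    intro x hx
    induction x using OnePoint.rec with
    | infty => simp [inversionInv]
    | coe p =>
      have hp : p ≠ 0 := fun h => hx (by simp [h])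
      rw [inversion_coe, inversionInv, if_neg (by simpa using hp)]
      exact congrArg _ (inv_norm_sq_smul_involutive p)
  right_inv' := by
    intro p _
    by_cases hp : p = 0
    · simp [inversionInv, hp]
    · rw [inversionInv, if_neg hp, inversion_coe]
      exact inv_norm_sq_smul_involutive p
  open_source := isOpen_compl_singleton
  open_target := isOpen_univ
  continuousOn_toFun := fun _ hx => (continuousAt_inversion hx).continuousWithinAt
  continuousOn_invFun := continuous_inversionInv.continuousOn

end Charts

/-! ### Flattening charts for the fixed point set. -/

namespace Diagram

variable (D : Diagram)

lemma isOpen_compl_image_balls : IsOpen ((fun p : E3 => (p : S3)) '' D.balls)ᶜ :=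
  (D.isCompact_balls.image OnePoint.continuous_coe).isClosed.isOpen_compl

lemma exists_chart_infty : ∃ φ : OpenPartialHomeomorph S3 E3, OnePoint.infty ∈ φ.source ∧
    ∀ x ∈ φ.source, (D.twistedReflection x = x ↔ (φ x) 2 = 0) := by
  refine ⟨inftyChart.restrOpen _ D.isOpen_compl_image_balls, by simp [inftyChart], ?_⟩
  intro x hx
  rw [OpenPartialHomeomorph.restrOpen_source] at hx
  obtain ⟨h0, hb⟩ := hx
  change _ ↔ (inversion x) 2 = 0
  induction x using OnePoint.rec with
  | infty => simp [twistedReflection_infty]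
  | coe p =>
    have hp : p ∉ D.balls := fun h => hb (mem_image_of_mem _ h)
    have h0' : p ≠ 0 := fun h => h0 (by simp [h])
    rw [twistedReflection_coe, D.twist_of_notMem_balls hp, OnePoint.coe_eq_coe,
      reflect_eq_self_iff]
    -- Inversion multiplies the last coordinate by a nonzero factor.
    simp [h0']

lemma exists_chart_of_notMem_balls {p : E3} (hp : p ∉ D.balls) :
    ∃ φ : OpenPartialHomeomorph S3 E3, (p : S3) ∈ φ.source ∧
      ∀ x ∈ φ.source, (D.twistedReflection x = x ↔ (φ x) 2 = 0) := by
  refine ⟨affineChart.restrOpen _ D.isOpen_compl_image_balls, ?_, ?_⟩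
  · rw [OpenPartialHomeomorph.restrOpen_source]
    exact ⟨coe_mem_affineChart_source p, fun h => hp (OnePoint.coe_injective.mem_set_image.1 h)⟩
  intro x hx
  rw [OpenPartialHomeomorph.restrOpen_source] at hx
  obtain ⟨h0, hb⟩ := hx
  change _ ↔ (affineChart x) 2 = 0
  induction x using OnePoint.rec with
  | infty => exact absurd h0 infty_notMem_affineChart_source
  | coe p =>
    have hp : p ∉ D.balls := fun h => hb (mem_image_of_mem _ h)
    rw [twistedReflection_coe, D.twist_of_notMem_balls hp, OnePoint.coe_eq_coe,
      reflect_eq_self_iff, affineChart_coe]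

/-- In the coordinates of the region the fixed set is the ribbon surface at angle `ribbonAngle`, and
`untwist` carries it to the coordinate plane. Restricting to `awayFromOthers` keeps the model
formula valid on the whole chart domain. -/
lemma exists_chart_of_mem_ball {i : Fin D.numRegions} {p : E3} (hp : p ∈ (D.region i).ball)
    (hc : p ∉ D.circles) :
    ∃ φ : OpenPartialHomeomorph S3 E3, (p : S3) ∈ φ.source ∧
      ∀ x ∈ φ.source, (D.twistedReflection x = x ↔ (φ x) 2 = 0) := by
  set T := D.region i with hT
  let e : OpenPartialHomeomorph E3 E3 := T.isOpenEmbedding_chart.toOpenPartialHomeomorph T.chart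
  have he : ∀ v, e.symm (T.chart v) = v := fun v => e.left_inv (mem_univ v)
  have hsrc : ∀ v, T.chart v ∈ e.symm.source := fun v => e.map_source (mem_univ v)
  let ψ : OpenPartialHomeomorph E3 E3 :=
    (e.symm.restrOpen _ (D.isOpen_awayFromOthers i)).trans (untwist T.halfTwists)
  have hψ : ∀ v, T.chart v ∈ ψ.source ↔ T.chart v ∈ D.awayFromOthers i ∧ v ∈ cylinder := by
    intro v
    rw [OpenPartialHomeomorph.trans_source, OpenPartialHomeomorph.restrOpen_source]
    change (T.chart v ∈ e.symm.source ∧ _) ∧ e.symm (T.chart v) ∈ cylinder ↔ _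
    rw [he]
    simp only [hsrc, true_and]
  refine ⟨affineChart.trans ψ, ?_, ?_⟩
  · rw [OpenPartialHomeomorph.trans_source]
    refine ⟨coe_mem_affineChart_source p, ?_⟩
    rw [mem_preimage, affineChart_coe]
    obtain ⟨v, hv, rfl⟩ := id hp
    refine (hψ v).2 ⟨D.ball_subset_awayFromOthers i hp, mem_cylinder_of_mem_modelBall hv ?_⟩
    exact fun h => hc (mem_iUnion_of_mem i (mem_image_of_mem _ h))
  · intro x hx
    rw [OpenPartialHomeomorph.trans_source] at hx
    obtain ⟨h0, hx⟩ := hx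
    induction x using OnePoint.rec with
    | infty => exact absurd h0 infty_notMem_affineChart_source
    | coe q =>
      rw [mem_preimage, affineChart_coe] at hx
      have hq : q ∈ range T.chart := by
        have h1 := hx
        rw [OpenPartialHomeomorph.trans_source, OpenPartialHomeomorph.restrOpen_source] at h1
        simpa [e] using h1.1.1
      obtain ⟨v, rfl⟩ := hq
      obtain ⟨ha, hv⟩ := (hψ v).1 hx
      rw [twistedReflection_coe, OnePoint.coe_eq_coe, hT,
        D.twist_chart i (D.mem_awayFromOthers.1 ha), T.isOpenEmbedding_chart.injective.eq_iff,
        modelFullTwist_reflect_eq_self_iff _ hv]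
      rw [OpenPartialHomeomorph.coe_trans, comp_apply, affineChart_coe]
      change _ ↔ (untwist T.halfTwists (e.symm (T.chart v))) 2 = 0
      rw [he]
      rfl

lemma exists_chart {x : S3} (hx : x ∉ D.link) :
    ∃ φ : OpenPartialHomeomorph S3 E3, x ∈ φ.source ∧
      ∀ y ∈ φ.source, (D.twistedReflection y = y ↔ (φ y) 2 = 0) := by
  induction x using OnePoint.rec with
  | infty => exact D.exists_chart_infty
  | coe p =>
    by_cases hp : p ∈ D.balls
    · obtain ⟨i, hi⟩ := mem_iUnion.1 hp
      exact D.exists_chart_of_mem_ball hi fun h => hx (D.coe_mem_link.2 (Or.inr h))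
    · exact D.exists_chart_of_notMem_balls hp

lemma exists_twistedReflection_ne : ∃ x, x ∉ D.link ∧ D.twistedReflection x ≠ x := by
  obtain ⟨R, hR⟩ := D.isCompact_balls.isBounded.exists_norm_le
  -- A point off the projection plane and beyond all balls is moved by the reflection. The absolute
  -- value is there because `R` may be negative if there are no balls.
  let p : E3 := !₂[0, 0, |R| + 1]
  have hp2 : p 2 = |R| + 1 := by simp [p]
  have hpos : 0 < |R| + 1 := by positivity
  have hp : p ∉ D.balls := by
    intro h
    have h1 := hR p h
    have h2 : ‖p 2‖ ≤ ‖p‖ := PiLp.norm_apply_le p 2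
    rw [hp2, Real.norm_of_nonneg hpos.le] at h2
    linarith [le_abs_self R]
  refine ⟨(p : S3), ?_, ?_⟩
  · rw [coe_mem_link]
    rintro (h | h)
    · have h2 : p 2 = 0 := D.planar_outside ⟨h, hp⟩
      linarith
    · obtain ⟨i, hi⟩ := mem_iUnion.1 h
      exact hp (mem_iUnion_of_mem i ((D.region i).crossingCircle_subset_ball hi))
  · rw [twistedReflection_coe, D.twist_of_notMem_balls hp, Ne, OnePoint.coe_eq_coe,
      reflect_eq_self_iff]
    linarith

/-! ### The involution of the link complement and its fixed surface. -/

/-- The twisted reflection of the complement of the image of the link under a homeomorphism of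
the three-sphere. -/
noncomputable def complInvolution (F : S3 ≃ₜ S3) {L : Set S3} (hL : F '' D.link = L) :
    (Lᶜ : Set S3) ≃ₜ (Lᶜ : Set S3) :=
  have hmem : ∀ x : S3, x ∈ L ↔ F.symm x ∈ D.link := fun x => by
    rw [← hL, F.image_eq_preimage_symm, mem_preimage]
  let f : (Lᶜ : Set S3) → (Lᶜ : Set S3) := fun x =>
    ⟨F (D.twistedReflection (F.symm x)), by
      rw [mem_compl_iff, hmem, F.symm_apply_apply, twistedReflection_mem_link, ← hmem]
      exact x.2⟩
  have hinv : Involutive f := fun x => Subtype.ext <| by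
    simp [f, D.twistedReflection_involutive _]
  have hcont : Continuous f := by
    refine Continuous.subtype_mk (continuous_iff_continuousAt.2 fun x => ?_) _
    have hx : F.symm x ∉ D.link := fun h => x.2 ((hmem x).2 h)
    exact F.continuous.continuousAt.comp (ContinuousAt.comp (D.continuousAt_twistedReflection hx)
      (F.symm.continuous.comp continuous_subtype_val).continuousAt)
  { toFun := f
    invFun := f
    left_inv := hinv
    right_inv := hinv
    continuous_toFun := hcont
    continuous_invFun := hcont }

lemma coe_complInvolution (F : S3 ≃ₜ S3) {L : Set S3} (hL : F '' D.link = L) (x : (Lᶜ : Set S3)) :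
    (D.complInvolution F hL x : S3) = F (D.twistedReflection (F.symm x)) := rfl

lemma complInvolution_eq_self_iff (F : S3 ≃ₜ S3) {L : Set S3} (hL : F '' D.link = L)
    (x : (Lᶜ : Set S3)) :
    D.complInvolution F hL x = x ↔ D.twistedReflection (F.symm x) = F.symm x := by
  rw [Subtype.ext_iff, coe_complInvolution, ← F.symm.injective.eq_iff, F.symm_apply_apply]

lemma isEmbeddedSurface_fixedPoints (F : S3 ≃ₜ S3) {L : Set S3} (hL : F '' D.link = L) :
    IsEmbeddedSurface {x | D.complInvolution F hL x = x} := by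
  refine ⟨isClosed_eq (D.complInvolution F hL).continuous continuous_id, fun x _ => ?_⟩
  have hx : F.symm x ∉ D.link := fun h => x.2 (hL.subset ⟨_, h, F.apply_symm_apply _⟩)
  obtain ⟨φ, hφ, hfix⟩ := D.exists_chart hx
  have hopen : IsOpen Lᶜ := by
    rw [← hL]
    exact (F.isClosedMap _ D.isClosed_link).isOpen_compl
  have hemb : IsOpenEmbedding fun y : (Lᶜ : Set S3) => F.symm y :=
    F.symm.isOpenEmbedding.comp hopen.isOpenEmbedding_subtypeVal
  have : Nonempty (Lᶜ : Set S3) := ⟨x⟩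
  refine ⟨(hemb.toOpenPartialHomeomorph _).trans φ, ?_, fun y hy => ?_⟩
  · simpa [OpenPartialHomeomorph.trans_source] using hφ
  · rw [mem_ofPred_eq, complInvolution_eq_self_iff]
    exact hfix _ (by simpa [OpenPartialHomeomorph.trans_source] using hy)

end Diagram

end AugLink

/-- `L` is a generalized augmented link: up to the homeomorphism `F` of the three-sphere, it is the
link of an augmented diagram `D`. The involution of its complement is (read through `F`)
the reflection in the projection plane followed by the full twists about the crossing circles
with half twists, and its fixed point set is a nonempty embedded surface. -/
theorem mainTheorem7 (L : Set AugLink.S3) (D : AugLink.Diagram) (F : AugLink.S3 ≃ₜ AugLink.S3)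
    (hL : F '' D.link = L) :
    ∃ σ : (Lᶜ : Set AugLink.S3) ≃ₜ (Lᶜ : Set AugLink.S3),
      (∀ x, ((σ x : (Lᶜ : Set AugLink.S3)) : AugLink.S3) = F (D.twistedReflection (F.symm x))) ∧
      (∀ x, σ (σ x) = x) ∧
      σ ≠ Homeomorph.refl _ ∧
      ∃ S : Set (Lᶜ : Set AugLink.S3), S.Nonempty ∧ AugLink.IsEmbeddedSurface S ∧
        {x | σ x = x} = S := by
  have hmem : ∀ x, x ∉ D.link → F x ∈ Lᶜ := by
    intro x hx h
    rw [← hL, F.injective.mem_set_image] at h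
    exact hx h
  refine ⟨D.complInvolution F hL, D.coe_complInvolution F hL,
    (D.complInvolution F hL).left_inv, ?_, _, ?_, D.isEmbeddedSurface_fixedPoints F hL, rfl⟩
  · intro h
    obtain ⟨x, hx, hne⟩ := D.exists_twistedReflection_ne
    have hfix : D.complInvolution F hL ⟨F x, hmem x hx⟩ = ⟨F x, hmem x hx⟩ := by rw [h]; rfl
    rw [D.complInvolution_eq_self_iff] at hfix
    simp only [F.symm_apply_apply] at hfix
    exact hne hfix
  -- The point at infinity is never on the link and is always fixed, so its image witnesses
  -- nonemptiness.
  · refine ⟨⟨F OnePoint.infty, hmem _ D.infty_notMem_link⟩, ?_⟩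
    rw [mem_ofPred_eq, D.complInvolution_eq_self_iff]
    simp only [F.symm_apply_apply]
    rfl
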